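/- Let $k, n, D \ge 0$ be integers, $\alpha\in[0,1]$, $C_w, C_b>0$. Consider a random feedforward ReLU network with $D$ layers of width $k$ and input dimension $n$ (the case $n=k$ included): $z^{(0)}=x\in\mathbb R^n$ and $z^{(d+1)}=\phi\bigl(W^{(d)}z^{(d)}+b^{(d)}\bigr)\in\mathbb R^k$, where $\phi(s)=\max(s,0)$ acts elementwise. All entries of the weight matrices $W^{(0)},\dots,W^{(D-1)}$ and bias vectors $b^{(0)},\dots,b^{(D-1)}$ are mutually independent, each weight having law $\alpha\,\mathcal U(-C_w,C_w)+(1-\alpha)\,\delta_0$ (that is, it is $0$ with probability $1-\alpha$ and uniform on $[-C_w,C_w]$ with probability $\alpha$) and each bias having law $\mathcal U(-C_b,C_b)$ (a sparse-uniform network). Let $x:[0,1]\to\mathbb R^n$ be a trajectory in input space, continuous and differentiable at almost every $t$, and let $z^{(d)}(t)$ be its image in layer $d$. The length of a trajectory $y$ is $l(y)=\int_0^1\|y'(t)\|\,dt\in[0,\infty]$, with the Euclidean norm. Then for every $0\le d\le D$, almost surely $z^{(d)}(t)$ is differentiable at almost every $t\in[0,1]$, its length $l(z^{(d)}(t))$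 is a random variable, and $$\mathbb E\bigl[l(z^{(d)}(t))\bigr]\;\ge\;\left(\frac{\alpha\,C_w\sqrt{k}}{4\sqrt2}\right)^{d}\, l(x(t)).$$ Moreover, if $w=(w_1,\dots,w_m)$ has independent entries with law $\mathcal U(-C_w,C_w)$, then $\mathbb E\,|u^\top w|\ge \frac{C_w}{2\sqrt2}\,\|u\|$ for every $m\ge 0$ and $u\in\mathbb R^m$. -/

import Mathlib

open MeasureTheory ProbabilityTheory Set

/-- Widths of the layers of a feedforward network with input dimension `n` whose layers
have width `k`: layer `0` is the input. -/
def layerWidth (n k : ℕ) : ℕ → ℕ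
  | 0 => n
  | _ + 1 => k

/-- The ReLU map, applied elementwise. -/
noncomputable def relu {k : ℕ} (h : Fin k → ℝ) : EuclideanSpace ℝ (Fin k) :=
  WithLp.toLp 2 (fun j => max (h j) 0)

/-- The post-activation vector `z⁽ᵈ⁾` of a ReLU network with `D` layers, weight matrices `W l`
and bias vectors `b l` (`l < D`), on the input `x`: `z⁽⁰⁾ = x` and
`z⁽ᵈ⁺¹⁾ = relu (W⁽ᵈ⁾ z⁽ᵈ⁾ + b⁽ᵈ⁾)`. -/
noncomputable def postActivation {n k D : ℕ}
    (W : (l : Fin D) → Matrix (Fin k) (Fin (layerWidth n k l)) ℝ)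
    (b : Fin D → Fin k → ℝ) (x : EuclideanSpace ℝ (Fin n)) :
    (d : ℕ) → d ≤ D → EuclideanSpace ℝ (Fin (layerWidth n k d))
  | 0, _ => x
  | d + 1, hd =>
      relu (Matrix.mulVec (W ⟨d, hd⟩) (postActivation W b x d (Nat.le_of_succ_le hd)).ofLp
        + b ⟨d, hd⟩)

/-- The length `∫₀¹ ‖x'(t)‖ dt` of a trajectory parametrised by `[0, 1]`, as an element
of `[0, ∞]`. -/
noncomputable def trajectoryLength {m : ℕ} (x : ℝ → EuclideanSpace ℝ (Fin m)) : ENNReal :=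
  ∫⁻ t in Icc (0 : ℝ) 1, ‖deriv x t‖ₑ

/-- The uniform distribution `U(-C, C)` (for `C > 0`). -/
noncomputable def symmUniform (C : ℝ) : Measure ℝ :=
  ProbabilityTheory.cond volume (Icc (-C) C)

/-- The mixture `α P + (1 - α) δ₀`. -/
noncomputable def sparseMixture (α : ℝ) (P : Measure ℝ) : Measure ℝ :=
  ENNReal.ofReal α • P + ENNReal.ofReal (1 - α) • Measure.dirac 0

/-- Random weights and biases form a random sparse network with sparsity parameter `α`: every
weight has law `α P + (1 - α) δ₀`, every bias has law `Q`, and all weights and biases, of all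
layers, are mutually independent. -/
structure IsRandomSparseNetwork {Ω : Type*} [MeasurableSpace Ω] (μ : Measure Ω) {n k D : ℕ}
    (α : ℝ) (P Q : Measure ℝ)
    (W : (l : Fin D) → Ω → Matrix (Fin k) (Fin (layerWidth n k l)) ℝ)
    (b : Fin D → Ω → Fin k → ℝ) : Prop where
  weight_law : ∀ l i j, HasLaw (fun ω => W l ω i j) (sparseMixture α P) μ
  bias_law : ∀ l i, HasLaw (fun ω => b l ω i) Q μ
  indep : iIndepFun
    (Sum.elim
      (fun (p : Σ l : Fin D, Fin k × Fin (layerWidth n k l)) (ω : Ω) => W p.1 ω p.2.1 p.2.2)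
      (fun (q : Fin D × Fin k) (ω : Ω) => b q.1 ω q.2)) μ

/-- A sparse-uniform network: a random sparse network with `P = U(-C_w, C_w)` and
`Q = U(-C_b, C_b)`. -/
def IsSparseUniformNetwork {Ω : Type*} [MeasurableSpace Ω] (μ : Measure Ω) {n k D : ℕ}
    (α C_w C_b : ℝ)
    (W : (l : Fin D) → Ω → Matrix (Fin k) (Fin (layerWidth n k l)) ℝ)
    (b : Fin D → Ω → Fin k → ℝ) : Prop :=
  IsRandomSparseNetwork μ α (symmUniform C_w) (symmUniform C_b) W b

/-! Fix a time `t` at which the input is differentiable, and let `v` be the derivative of the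
trajectory in layer `d`. A neuron of the next layer contributes `|w · v|` to the speed if it is
active and `0` otherwise, and its weights and bias are independent of the lower layers. Negating
`(w, β)` preserves their joint law and `|w · v|` but exchanges active and inactive, since an
atomless bias makes the pre-activation almost surely nonzero. Hence activity costs exactly a factor
`1/2` (`lintegral_active_eq`).

For a symmetric law, `E|w · v| ≥ ‖v‖ E|w₁| / √2` (`enorm_mul_lintegral_enorm_le`): random signs may
be inserted for free, Khintchine's inequality with constant `1/√2` (`sqrt_sum_sq_le_cubeMean`)
bounds the sign average below by `√(∑ vᵢ² wᵢ²)`, and by Cauchy–Schwarz `‖v‖` times this root is at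
least `∑ vᵢ² |wᵢ|`, whose mean is `‖v‖² E|w₁|`. This applies to the sparse mixture itself, where
`E|w₁| = α C_w / 2`, so no conditioning on the sparsity pattern is needed.

Summing over `k` neurons and comparing the `ℓ¹` and `ℓ²` norms gives the factor `√k · (α C_w / 2) /
(2√2)` per layer (`lintegral_enorm_deriv_paramNet_succ`). Induction on `d` and Tonelli in `(θ, t)`
finish the proof. -/

/-! ### Khintchine's inequality on the sign cube -/

/-- The mean of a function over the sign cube. -/
noncomputable def cubeMean (n : ℕ) (f : (Fin n → ℤˣ) → ℝ) : ℝ :=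
  (∑ ε, f ε) / 2 ^ n

/-- The Dirichlet energy of a function on the sign cube. -/
noncomputable def cubeEnergy (n : ℕ) (f : (Fin n → ℤˣ) → ℝ) : ℝ :=
  ∑ i, cubeMean n (fun ε => ((f ε - f (Function.update ε i (-ε i))) / 2) ^ 2)

/-- A sign as a real number. -/
def signVal (s : ℤˣ) : ℝ := ((s : ℤ) : ℝ)

@[simp] lemma signVal_one : signVal 1 = 1 := by simp [signVal]

@[simp] lemma signVal_neg (s : ℤˣ) : signVal (-s) = -signVal s := by simp [signVal]

lemma cubeMean_zero (f : (Fin 0 → ℤˣ) → ℝ) : cubeMean 0 f = f default := by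
  simp only [cubeMean, Fintype.sum_unique, pow_zero, div_one]
  exact congrArg f (Subsingleton.elim _ _)

lemma cubeMean_succ (n : ℕ) (f : (Fin (n + 1) → ℤˣ) → ℝ) :
    cubeMean (n + 1) f =
      cubeMean n (fun ε => (f (Fin.cons 1 ε) + f (Fin.cons (-1) ε)) / 2) := by
  unfold cubeMean
  rw [← (Fin.consEquiv fun _ => ℤˣ).sum_comp, Fintype.sum_prod_type]
  have h : (Finset.univ : Finset ℤˣ) = {1, -1} := rfl
  rw [h, Finset.sum_pair (by decide), ← Finset.sum_add_distrib, ← Finset.sum_div]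
  simp only [Fin.consEquiv, Equiv.coe_fn_mk]
  field_simp
  ring

lemma cubeMean_add (n : ℕ) (f g : (Fin n → ℤˣ) → ℝ) :
    cubeMean n (fun ε => f ε + g ε) = cubeMean n f + cubeMean n g := by
  simp only [cubeMean, Finset.sum_add_distrib, add_div]

lemma cubeMean_sub (n : ℕ) (f g : (Fin n → ℤˣ) → ℝ) :
    cubeMean n (fun ε => f ε - g ε) = cubeMean n f - cubeMean n g := by
  simp only [cubeMean, Finset.sum_sub_distrib, sub_div]

lemma cubeMean_const_mul (n : ℕ) (c : ℝ) (f : (Fin n → ℤˣ) → ℝ) :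
    cubeMean n (fun ε => c * f ε) = c * cubeMean n f := by
  simp only [cubeMean, ← Finset.mul_sum, mul_div_assoc]

lemma cubeMean_const (n : ℕ) (c : ℝ) : cubeMean n (fun _ => c) = c := by
  simp [cubeMean]

lemma cubeMean_sum {ι : Type*} (n : ℕ) (s : Finset ι) (f : ι → (Fin n → ℤˣ) → ℝ) :
    cubeMean n (fun ε => ∑ i ∈ s, f i ε) = ∑ i ∈ s, cubeMean n (f i) := by
  simp only [cubeMean, Finset.sum_div]
  rw [Finset.sum_comm]

lemma cubeMean_mono (n : ℕ) {f g : (Fin n → ℤˣ) → ℝ} (h : ∀ ε, f ε ≤ g ε) :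
    cubeMean n f ≤ cubeMean n g := by
  unfold cubeMean
  gcongr
  exact h _

lemma sq_cubeMean_le (n : ℕ) (f : (Fin n → ℤˣ) → ℝ) :
    cubeMean n f ^ 2 ≤ cubeMean n (fun ε => f ε ^ 2) := by
  have h : 0 ≤ cubeMean n (fun ε => (f ε - cubeMean n f) ^ 2) := by
    rw [← cubeMean_const n 0]
    exact cubeMean_mono n fun ε => sq_nonneg _
  have h' : (fun ε => (f ε - cubeMean n f) ^ 2) =
      fun ε => (f ε ^ 2 - 2 * cubeMean n f * f ε) + cubeMean n f ^ 2 := by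
    ext ε; ring
  rw [h', cubeMean_add, cubeMean_sub, cubeMean_const_mul, cubeMean_const] at h
  linarith

lemma cubeMean_comp_neg (n : ℕ) (f : (Fin n → ℤˣ) → ℝ) :
    cubeMean n (fun ε => f (-ε)) = cubeMean n f :=
  congrArg (· / _) (Equiv.sum_comp (Equiv.neg (Fin n → ℤˣ)) f)

lemma cubeMean_comp_flip (n : ℕ) (i : Fin n) (f : (Fin n → ℤˣ) → ℝ) :
    cubeMean n (fun ε => f (Function.update ε i (-ε i))) = cubeMean n f := by
  unfold cubeMean
  congr 1
  have hinv : Function.Involutive fun ε : Fin n → ℤˣ => Function.update ε i (-ε i) := by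
    intro ε
    simp
  exact Equiv.sum_comp hinv.toPerm f

/-- Write `f = g + ε₀ h` with `g`, `h` free of `ε₀`. Flipping `ε₀` isolates `h`; for every other
coordinate the cross term averages out over `ε₀`. -/
lemma cubeEnergy_succ (n : ℕ) (f : (Fin (n + 1) → ℤˣ) → ℝ) :
    cubeEnergy (n + 1) f =
      cubeMean n (fun ε => ((f (Fin.cons 1 ε) - f (Fin.cons (-1) ε)) / 2) ^ 2)
      + cubeEnergy n (fun ε => (f (Fin.cons 1 ε) + f (Fin.cons (-1) ε)) / 2)
      + cubeEnergy n (fun ε => (f (Fin.cons 1 ε) - f (Fin.cons (-1) ε)) / 2) := by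
  unfold cubeEnergy
  rw [Fin.sum_univ_succ, add_assoc, ← Finset.sum_add_distrib]
  congr 1
  · rw [cubeMean_succ]
    congr 1
    ext ε
    simp only [Fin.cons_zero, Fin.update_cons_zero, neg_neg]
    ring
  · refine Finset.sum_congr rfl fun i _ => ?_
    rw [cubeMean_succ, ← cubeMean_add]
    congr 1
    ext ε
    simp only [Fin.cons_succ, ← Fin.cons_update]
    ring

/-- The Poincaré inequality on the sign cube. -/
lemma cube_variance_le_energy (n : ℕ) (f : (Fin n → ℤˣ) → ℝ) :
    cubeMean n (fun ε => f ε ^ 2) - cubeMean n f ^ 2 ≤ cubeEnergy n f := by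
  induction n with
  | zero => simp [cubeMean_zero, cubeEnergy]
  | succ n ih =>
    rw [cubeEnergy_succ, cubeMean_succ, cubeMean_succ n f]
    have hg := ih (fun ε => (f (Fin.cons 1 ε) + f (Fin.cons (-1) ε)) / 2)
    have hh := ih (fun ε => (f (Fin.cons 1 ε) - f (Fin.cons (-1) ε)) / 2)
    -- With `hh`, this says that the energy of the half-difference is nonnegative.
    have hs := sq_cubeMean_le n (fun ε => (f (Fin.cons 1 ε) - f (Fin.cons (-1) ε)) / 2)
    have h : (fun ε : Fin n → ℤˣ => (f (Fin.cons 1 ε) ^ 2 + f (Fin.cons (-1) ε) ^ 2) / 2) =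
        fun ε => ((f (Fin.cons 1 ε) + f (Fin.cons (-1) ε)) / 2) ^ 2
          + ((f (Fin.cons 1 ε) - f (Fin.cons (-1) ε)) / 2) ^ 2 := by
      ext ε; ring
    rw [h, cubeMean_add]
    linarith

/-- The Poincaré inequality on the sign cube, improved by a factor of two away from the first
level of the Walsh expansion. -/
lemma cube_two_mul_variance_le (n : ℕ) (f : (Fin n → ℤˣ) → ℝ) :
    2 * (cubeMean n (fun ε => f ε ^ 2) - cubeMean n f ^ 2) ≤
      cubeEnergy n f + ∑ i, cubeMean n (fun ε => signVal (ε i) * f ε) ^ 2 := by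
  induction n with
  | zero => simp [cubeMean_zero, cubeEnergy]
  | succ n ih =>
    rw [cubeEnergy_succ, cubeMean_succ, cubeMean_succ n f, Fin.sum_univ_succ]
    have hg := ih (fun ε => (f (Fin.cons 1 ε) + f (Fin.cons (-1) ε)) / 2)
    -- For `f = g + ε₀ h`, twice the variance is `2 Var g + 2 E h²`. One `E h²` occurs in the
    -- energy; the other is `Var h + (E h)²`, where plain Poincaré bounds `Var h` and `E h` is the
    -- first-level coefficient at `ε₀`.
    have hh := cube_variance_le_energy n (fun ε => (f (Fin.cons 1 ε) - f (Fin.cons (-1) ε)) / 2)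
    have h : (fun ε : Fin n → ℤˣ => (f (Fin.cons 1 ε) ^ 2 + f (Fin.cons (-1) ε) ^ 2) / 2) =
        fun ε => ((f (Fin.cons 1 ε) + f (Fin.cons (-1) ε)) / 2) ^ 2
          + ((f (Fin.cons 1 ε) - f (Fin.cons (-1) ε)) / 2) ^ 2 := by
      ext ε; ring
    have h0 : cubeMean (n + 1) (fun ε => signVal (ε 0) * f ε) =
        cubeMean n (fun ε => (f (Fin.cons 1 ε) - f (Fin.cons (-1) ε)) / 2) := by
      rw [cubeMean_succ]
      congr 1
      ext ε
      simp only [Fin.cons_zero, signVal_one, signVal_neg]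
      ring
    have hi : ∀ i : Fin n, cubeMean (n + 1) (fun ε => signVal (ε i.succ) * f ε) =
        cubeMean n (fun ε => signVal (ε i) * ((f (Fin.cons 1 ε) + f (Fin.cons (-1) ε)) / 2)) := by
      intro i
      rw [cubeMean_succ]
      congr 1
      ext ε
      simp only [Fin.cons_succ]
      ring
    simp only [h0, hi]
    rw [h, cubeMean_add]
    linarith

lemma cubeMean_sq_add_sum (n : ℕ) (c : ℝ) (a : Fin n → ℝ) :
    cubeMean n (fun ε => (c + ∑ i, signVal (ε i) * a i) ^ 2) = c ^ 2 + ∑ i, a i ^ 2 := by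
  induction n generalizing c with
  | zero => simp [cubeMean_zero]
  | succ n ih =>
    rw [cubeMean_succ]
    simp only [Fin.sum_univ_succ, Fin.cons_zero, Fin.cons_succ, signVal_one, signVal_neg,
      add_div, cubeMean_add, ← add_assoc]
    simp only [div_eq_inv_mul, cubeMean_const_mul, ih]
    ring

/-- A flip preserves the mean, so the energy is the mean of `f · ∑ᵢ (f - f ∘ flipᵢ) / 2`. The linear
form sums to `n - 2` times itself over the `n` flips, so the triangle inequality gives `∑ᵢ f ∘ flipᵢ
≥ (n - 2) f` pointwise. -/
lemma cubeEnergy_abs_sum_le (n : ℕ) (a : Fin n → ℝ) :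
    cubeEnergy n (fun ε => |∑ i, signVal (ε i) * a i|) ≤
      cubeMean n (fun ε => |∑ i, signVal (ε i) * a i| ^ 2) := by
  set f : (Fin n → ℤˣ) → ℝ := fun ε => |∑ i, signVal (ε i) * a i| with hf
  have hflip : ∀ i, cubeMean n (fun ε => ((f ε - f (Function.update ε i (-ε i))) / 2) ^ 2) =
      cubeMean n (fun ε => f ε * (f ε - f (Function.update ε i (-ε i))) / 2) := by
    intro i
    have h := cubeMean_comp_flip n i (fun ε => f ε ^ 2)
    have e1 : (fun ε => ((f ε - f (Function.update ε i (-ε i))) / 2) ^ 2) =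
        fun ε => (1 / 4 * f ε ^ 2 + 1 / 4 * f (Function.update ε i (-ε i)) ^ 2)
          - 1 / 2 * (f ε * f (Function.update ε i (-ε i))) := by
      ext ε; ring
    have e2 : (fun ε => f ε * (f ε - f (Function.update ε i (-ε i))) / 2) =
        fun ε => 1 / 2 * f ε ^ 2 - 1 / 2 * (f ε * f (Function.update ε i (-ε i))) := by
      ext ε; ring
    rw [e1, e2, cubeMean_sub, cubeMean_sub, cubeMean_add]
    simp only [cubeMean_const_mul]
    rw [h]
    ring
  unfold cubeEnergy
  simp only [hflip]
  rw [← cubeMean_sum]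
  refine cubeMean_mono n fun ε => ?_
  have hval : ∀ i, ∑ j, signVal (Function.update ε i (-ε i) j) * a j =
      ∑ j, signVal (ε j) * a j - 2 * (signVal (ε i) * a i) := by
    intro i
    rw [← Finset.add_sum_erase _ _ (Finset.mem_univ i),
      ← Finset.add_sum_erase _ (fun j => signVal (ε j) * a j) (Finset.mem_univ i)]
    have : ∑ j ∈ Finset.univ.erase i, signVal (Function.update ε i (-ε i) j) * a j =
        ∑ j ∈ Finset.univ.erase i, signVal (ε j) * a j :=
      Finset.sum_congr rfl fun j hj => by
        rw [Function.update_of_ne (Finset.ne_of_mem_erase hj)]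
    rw [this, Function.update_self, signVal_neg]
    ring
  have hsum : ((n : ℝ) - 2) * f ε ≤ ∑ i, f (Function.update ε i (-ε i)) := by
    have h1 : ∑ i, (∑ j, signVal (Function.update ε i (-ε i) j) * a j) =
        ((n : ℝ) - 2) * ∑ j, signVal (ε j) * a j := by
      simp only [hval, Finset.sum_sub_distrib, ← Finset.mul_sum]
      simp
      ring
    calc ((n : ℝ) - 2) * f ε ≤ |(n : ℝ) - 2| * f ε := by
          exact mul_le_mul_of_nonneg_right (le_abs_self _) (abs_nonneg _)
      _ = |∑ i, (∑ j, signVal (Function.update ε i (-ε i) j) * a j)| := by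
          rw [h1, abs_mul]
      _ ≤ _ := Finset.abs_sum_le_sum_abs _ _
  have hfn : 0 ≤ f ε := abs_nonneg _
  calc ∑ i, f ε * (f ε - f (Function.update ε i (-ε i))) / 2
      = f ε * (n * f ε - ∑ i, f (Function.update ε i (-ε i))) / 2 := by
        rw [← Finset.sum_div, ← Finset.mul_sum, Finset.sum_sub_distrib]
        simp
    _ ≤ f ε * (2 * f ε) / 2 := by
        gcongr
        linarith
    _ = f ε ^ 2 := by ring

/-- Khintchine's inequality in `L¹` with the optimal constant, by the argument of Latała and
Oleszkiewicz. -/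
theorem sqrt_sum_sq_le_cubeMean (n : ℕ) (a : Fin n → ℝ) :
    √(∑ i, a i ^ 2) ≤ √2 * cubeMean n (fun ε => |∑ i, signVal (ε i) * a i|) := by
  have h1 := cube_two_mul_variance_le n (fun ε => |∑ i, signVal (ε i) * a i|)
  have h2 := cubeEnergy_abs_sum_le n a
  -- The absolute value is even in `ε`, so its first Walsh level vanishes and the factor two in the
  -- improved Poincaré inequality is available.
  have h3 : ∀ i, cubeMean n (fun ε => signVal (ε i) * |∑ i, signVal (ε i) * a i|) = 0 := by
    intro i
    have h := cubeMean_comp_neg n (fun ε => signVal (ε i) * |∑ i, signVal (ε i) * a i|)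
    simp only [Pi.neg_apply, signVal_neg, neg_mul, Finset.sum_neg_distrib, abs_neg] at h
    have h' := cubeMean_const_mul n (-1) (fun ε => signVal (ε i) * |∑ i, signVal (ε i) * a i|)
    simp only [neg_mul, one_mul] at h'
    linarith
  have h4 := cubeMean_sq_add_sum n 0 a
  simp only [zero_add] at h4
  simp only [h3] at h1
  simp only [sq_abs] at h1 h2
  have h0 : 0 ≤ cubeMean n (fun ε => |∑ i, signVal (ε i) * a i|) := by
    rw [← cubeMean_const n 0]
    exact cubeMean_mono n fun ε => abs_nonneg _
  rw [← Real.sqrt_sq h0, ← Real.sqrt_mul (by norm_num)]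
  apply Real.sqrt_le_sqrt
  rw [h4] at h1 h2
  simp at h1
  linarith

/-! ### First moments of linear forms in symmetric variables -/

lemma measurePreserving_signVal_mul {P : Measure ℝ}
    (hP : MeasurePreserving (fun s : ℝ => -s) P P) (e : ℤˣ) :
    MeasurePreserving (fun s : ℝ => signVal e * s) P P := by
  rcases Int.units_eq_one_or e with rfl | rfl
  · simp only [signVal_one, one_mul]
    exact MeasurePreserving.id P
  · simpa using hP

/-- Symmetrisation: each pattern of sign changes preserves the product law, so all terms of the
average have the same integral. -/
lemma lintegral_cubeMean_signVal {P : Measure ℝ} [IsProbabilityMeasure P]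
    (hP : MeasurePreserving (fun s : ℝ => -s) P P) (m : ℕ) (u : Fin m → ℝ) :
    ∫⁻ w, ENNReal.ofReal (cubeMean m (fun ε => |∑ i, signVal (ε i) * (u i * w i)|))
      ∂(Measure.pi fun _ => P) = ∫⁻ w, ‖∑ i, u i * w i‖ₑ ∂(Measure.pi fun _ => P) := by
  have hε : ∀ ε : Fin m → ℤˣ, ∫⁻ w, ENNReal.ofReal |∑ i, signVal (ε i) * (u i * w i)|
      ∂(Measure.pi fun _ => P) = ∫⁻ w, ‖∑ i, u i * w i‖ₑ ∂(Measure.pi fun _ => P) := by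
    intro ε
    have h := measurePreserving_pi (fun _ : Fin m => P) (fun _ => P)
      (fun i => measurePreserving_signVal_mul hP (ε i))
    rw [← h.lintegral_comp (f := fun w => ‖∑ i, u i * w i‖ₑ) (by fun_prop)]
    refine lintegral_congr fun w => ?_
    rw [Real.enorm_eq_ofReal_abs]
    congr 3
    ext i
    ring
  have h2 : (0 : ℝ) < 2 ^ m := by positivity
  have hm : ∀ w : Fin m → ℝ,
      ENNReal.ofReal (cubeMean m (fun ε => |∑ i, signVal (ε i) * (u i * w i)|)) =
      ENNReal.ofReal (2 ^ m)⁻¹ * ∑ ε : Fin m → ℤˣ,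
        ENNReal.ofReal |∑ i, signVal (ε i) * (u i * w i)| := by
    intro w
    rw [cubeMean, div_eq_inv_mul, ENNReal.ofReal_mul (by positivity),
      ENNReal.ofReal_sum_of_nonneg fun _ _ => abs_nonneg _]
  simp only [hm]
  rw [lintegral_const_mul _ (by fun_prop), lintegral_finsetSum _ (by fun_prop)]
  simp only [hε]
  rw [Finset.sum_const, nsmul_eq_mul, ← mul_assoc]
  have hc : ((Finset.univ : Finset (Fin m → ℤˣ)).card : ENNReal) = ENNReal.ofReal (2 ^ m) := by
    rw [Finset.card_univ, Fintype.card_fun]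
    simp [ENNReal.ofReal_pow]
  rw [hc, ← ENNReal.ofReal_mul (by positivity), inv_mul_cancel₀ h2.ne']
  simp

/-- The first moment of a linear combination of independent symmetric variables with a common
law is bounded below by the Euclidean norm of the coefficients. -/
theorem enorm_mul_lintegral_enorm_le {P : Measure ℝ} [IsProbabilityMeasure P]
    (hP : MeasurePreserving (fun s : ℝ => -s) P P) {m : ℕ} (u : EuclideanSpace ℝ (Fin m)) :
    ‖u‖ₑ * ∫⁻ s, ‖s‖ₑ ∂P ≤
      ENNReal.ofReal √2 * ∫⁻ w, ‖∑ i, u i * w i‖ₑ ∂(Measure.pi fun _ => P) := by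
  rcases eq_or_ne u 0 with rfl | hu
  · simp
  -- The weights `u i ^ 2` are chosen so that the left side is linear in the `|w i|` and integrates
  -- to `‖u‖²` times the common first moment.
  have hpt : ∀ w : Fin m → ℝ, ∑ i, u i ^ 2 * |w i| ≤
      ‖u‖ * (√2 * cubeMean m (fun ε => |∑ i, signVal (ε i) * (u i * w i)|)) := by
    intro w
    have h1 := sqrt_sum_sq_le_cubeMean m (fun i => u i * w i)
    calc ∑ i, u i ^ 2 * |w i| = ∑ i, |u i| * |u i * w i| := by
          refine Finset.sum_congr rfl fun i _ => ?_
          rw [abs_mul, ← mul_assoc, abs_mul_abs_self, sq]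
      _ ≤ √(∑ i, |u i| ^ 2) * √(∑ i, |u i * w i| ^ 2) := Real.sum_mul_le_sqrt_mul_sqrt _ _ _
      _ = ‖u‖ * √(∑ i, (u i * w i) ^ 2) := by
          simp only [EuclideanSpace.norm_eq, sq_abs, Real.norm_eq_abs]
      _ ≤ _ := by gcongr
  have hint : ∫⁻ w, ENNReal.ofReal (∑ i, u i ^ 2 * |w i|) ∂(Measure.pi fun _ : Fin m => P) =
      ‖u‖ₑ * (‖u‖ₑ * ∫⁻ s, ‖s‖ₑ ∂P) := by
    have e : ∀ w : Fin m → ℝ, ENNReal.ofReal (∑ i, u i ^ 2 * |w i|) =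
        ∑ i, ENNReal.ofReal (u i ^ 2) * ‖w i‖ₑ := by
      intro w
      rw [ENNReal.ofReal_sum_of_nonneg fun _ _ => by positivity]
      refine Finset.sum_congr rfl fun i _ => ?_
      rw [ENNReal.ofReal_mul (sq_nonneg _), Real.enorm_eq_ofReal_abs]
    have e2 : ∀ i : Fin m, ∫⁻ w, ‖w i‖ₑ ∂(Measure.pi fun _ : Fin m => P) = ∫⁻ s, ‖s‖ₑ ∂P :=
      fun i => (measurePreserving_eval (fun _ : Fin m => P) i).lintegral_comp
        (f := fun s => ‖s‖ₑ) (by fun_prop)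
    simp only [e]
    rw [lintegral_finsetSum _ (by fun_prop)]
    have e3 : ∀ i : Fin m, ∫⁻ w, ENNReal.ofReal (u i ^ 2) * ‖w i‖ₑ
        ∂(Measure.pi fun _ : Fin m => P) = ENNReal.ofReal (u i ^ 2) * ∫⁻ s, ‖s‖ₑ ∂P := by
      intro i
      rw [lintegral_const_mul _ (by fun_prop), e2]
    simp only [e3]
    rw [← Finset.sum_mul, ← mul_assoc, ← ENNReal.ofReal_sum_of_nonneg fun _ _ => sq_nonneg _,
      ← EuclideanSpace.real_norm_sq_eq, sq, ENNReal.ofReal_mul (norm_nonneg _), ofReal_norm]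
  have hu0 : ‖u‖ₑ ≠ 0 := by simpa using hu
  -- After multiplication by `‖u‖ₑ` the claim is the integral of `hpt`.
  rw [← ENNReal.mul_le_mul_iff_right hu0 enorm_ne_top, ← hint,
    ← lintegral_cubeMean_signVal hP m (fun i => u i), ← ofReal_norm]
  have hmeas : Measurable fun w : Fin m → ℝ =>
      ENNReal.ofReal (cubeMean m (fun ε => |∑ i, signVal (ε i) * (u i * w i)|)) := by
    unfold cubeMean
    fun_prop
  rw [← lintegral_const_mul _ hmeas, ← lintegral_const_mul _ (hmeas.const_mul _)]
  refine lintegral_mono fun w => ?_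
  rw [← ENNReal.ofReal_mul (Real.sqrt_nonneg _), ← ENNReal.ofReal_mul (norm_nonneg _)]
  exact ENNReal.ofReal_le_ofReal (hpt w)

/-! ### The uniform law and its sparse mixture -/

lemma isProbabilityMeasure_symmUniform {C : ℝ} (hC : 0 < C) :
    IsProbabilityMeasure (symmUniform C) := by
  apply cond_isProbabilityMeasure_of_finite <;> simp [Real.volume_Icc, hC]

lemma measurePreserving_neg_symmUniform (C : ℝ) :
    MeasurePreserving (fun s : ℝ => -s) (symmUniform C) (symmUniform C) := by
  unfold symmUniform ProbabilityTheory.cond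
  apply MeasurePreserving.smul_measure
  have h := (Measure.measurePreserving_neg (volume : Measure ℝ)).restrict_preimage
    (s := Icc (-C) C) measurableSet_Icc
  have e : Neg.neg ⁻¹' Icc (-C) C = Icc (-C) C := by
    ext s
    simp only [mem_preimage, mem_Icc]
    constructor <;> rintro ⟨h1, h2⟩ <;> constructor <;> linarith
  rwa [e] at h

lemma nullSingletonClass_symmUniform (C : ℝ) : NullSingletonClass (symmUniform C) := by
  constructor
  intro s
  simp [symmUniform, ProbabilityTheory.cond]

lemma lintegral_enorm_symmUniform {C : ℝ} (hC : 0 < C) :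
    ∫⁻ s, ‖s‖ₑ ∂(symmUniform C) = ENNReal.ofReal (C / 2) := by
  have hint : ∫ s in Icc (-C) C, ‖s‖ = C ^ 2 := by
    rw [integral_Icc_eq_integral_Ioc, ← intervalIntegral.integral_of_le (by linarith)]
    have hii : ∀ a b : ℝ, IntervalIntegrable (fun s : ℝ => ‖s‖) volume a b :=
      fun a b => continuous_norm.intervalIntegrable a b
    rw [← intervalIntegral.integral_add_adjacent_intervals (hii (-C) 0) (hii 0 C)]
    have h1 : ∫ s in (-C)..0, ‖s‖ = ∫ s in (-C)..0, -s :=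
      intervalIntegral.integral_congr fun s hs => by
        rw [uIcc_of_le (by linarith)] at hs
        exact abs_of_nonpos hs.2
    have h2 : ∫ s in (0 : ℝ)..C, ‖s‖ = ∫ s in (0 : ℝ)..C, s :=
      intervalIntegral.integral_congr fun s hs => by
        rw [uIcc_of_le hC.le] at hs
        exact abs_of_nonneg hs.1
    rw [h1, h2, intervalIntegral.integral_neg, integral_id, integral_id]
    ring
  have hl : ∫⁻ s in Icc (-C) C, ‖s‖ₑ = ENNReal.ofReal (C ^ 2) := by
    rw [← hint, ofReal_integral_norm_eq_lintegral_enorm]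
    exact continuous_id.integrableOn_Icc
  rw [symmUniform, ProbabilityTheory.cond, lintegral_smul_measure, hl, Real.volume_Icc,
    ← ENNReal.ofReal_inv_of_pos (by linarith), smul_eq_mul,
    ← ENNReal.ofReal_mul (inv_nonneg.2 (by linarith))]
  congr 1
  field_simp
  ring

lemma lintegral_enorm_sparseMixture {α C : ℝ} (hα : 0 ≤ α) (hC : 0 < C) :
    ∫⁻ s, ‖s‖ₑ ∂(sparseMixture α (symmUniform C)) = ENNReal.ofReal (α * C / 2) := by
  rw [sparseMixture, lintegral_add_measure, lintegral_smul_measure, lintegral_smul_measure,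
    lintegral_enorm_symmUniform hC, lintegral_dirac]
  simp [← ENNReal.ofReal_mul hα, mul_div_assoc]

lemma isProbabilityMeasure_sparseMixture {α : ℝ} (hα : α ∈ Icc (0 : ℝ) 1) (P : Measure ℝ)
    [IsProbabilityMeasure P] : IsProbabilityMeasure (sparseMixture α P) := by
  constructor
  have h := hα.2
  simp [sparseMixture, ← ENNReal.ofReal_add hα.1 (sub_nonneg.2 h)]

lemma measurePreserving_neg_sparseMixture (α : ℝ) {P : Measure ℝ}
    (hP : MeasurePreserving (fun s : ℝ => -s) P P) :
    MeasurePreserving (fun s : ℝ => -s) (sparseMixture α P) (sparseMixture α P) := by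
  refine ⟨measurable_neg, ?_⟩
  rw [sparseMixture, Measure.map_add _ _ measurable_neg, Measure.map_smul, Measure.map_smul,
    hP.map_eq, Measure.map_dirac' measurable_neg, neg_zero]

lemma integrable_sum_mul_symmUniform {C : ℝ} (hC : 0 < C) (m : ℕ) (u : Fin m → ℝ) :
    Integrable (fun w : Fin m → ℝ => ∑ i, u i * w i) (Measure.pi fun _ => symmUniform C) := by
  have := isProbabilityMeasure_symmUniform hC
  refine integrable_finsetSum _ fun i _ => Integrable.const_mul ?_ _
  refine integrable_comp_eval (μ := fun _ : Fin m => symmUniform C) (f := fun s : ℝ => s) ?_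
  refine ⟨by fun_prop, ?_⟩
  rw [HasFiniteIntegral, lintegral_enorm_symmUniform hC]
  exact ENNReal.ofReal_lt_top

/-- The moment bound for linear combinations of independent symmetric uniform variables. -/
theorem mul_norm_le_integral_abs_symmUniform {C : ℝ} (hC : 0 < C) (m : ℕ)
    (u : EuclideanSpace ℝ (Fin m)) :
    C / (2 * √2) * ‖u‖ ≤
      ∫ w : Fin m → ℝ, |∑ i, u i * w i| ∂(Measure.pi fun _ => symmUniform C) := by
  have := isProbabilityMeasure_symmUniform hC
  have h := enorm_mul_lintegral_enorm_le (measurePreserving_neg_symmUniform C) u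
  rw [lintegral_enorm_symmUniform hC,
    ← ofReal_integral_norm_eq_lintegral_enorm (integrable_sum_mul_symmUniform hC m _),
    ← ofReal_norm, ← ENNReal.ofReal_mul (norm_nonneg _), ← ENNReal.ofReal_mul (Real.sqrt_nonneg _),
    ENNReal.ofReal_le_ofReal_iff
      (mul_nonneg (Real.sqrt_nonneg _) (integral_nonneg fun _ => norm_nonneg _))] at h
  simp only [Real.norm_eq_abs] at h
  have h2 : (0 : ℝ) < √2 := by positivity
  calc C / (2 * √2) * ‖u‖ = ‖u‖ * (C / 2) / √2 := by field_simp
    _ ≤ _ := by rw [div_le_iff₀' h2]; exact h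

/-! ### A single neuron -/

section Row

variable {P Q : Measure ℝ} [IsProbabilityMeasure P] [IsProbabilityMeasure Q] {m : ℕ}

/-- For fixed weights only one value of the bias is excluded, and it has mass zero. -/
lemma ae_preactivation_ne_zero (P : Measure ℝ) [IsProbabilityMeasure P]
    (hQa : NullSingletonClass Q) (z : Fin m → ℝ) :
    ∀ᵐ p ∂(Measure.pi fun _ : Fin m => P).prod Q, ∑ i, p.1 i * z i + p.2 ≠ 0 := by
  have hms : MeasurableSet {p : (Fin m → ℝ) × ℝ | ∑ i, p.1 i * z i + p.2 ≠ 0} :=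
    (measurableSet_singleton (0 : ℝ)).compl.preimage (by fun_prop)
  rw [Measure.ae_prod_iff_ae_ae hms]
  refine .of_forall fun w => ?_
  filter_upwards [compl_mem_ae_iff.2 (measure_singleton (μ := Q) (-∑ i, w i * z i))] with β hβ h0
  exact hβ (eq_neg_of_add_eq_zero_right h0)

/-- A ReLU neuron with symmetric weights and symmetric atomless bias is active with probability
one half, independently of the size of the directional derivative of its pre-activation. -/
lemma lintegral_active_eq (hP : MeasurePreserving (fun s : ℝ => -s) P P)
    (hQ : MeasurePreserving (fun s : ℝ => -s) Q Q) (hQa : NullSingletonClass Q)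
    (z v : Fin m → ℝ) :
    2 * ∫⁻ p, {p : (Fin m → ℝ) × ℝ | 0 < ∑ i, p.1 i * z i + p.2}.indicator
        (fun p => ‖∑ i, p.1 i * v i‖ₑ) p ∂(Measure.pi fun _ : Fin m => P).prod Q =
      ∫⁻ w, ‖∑ i, v i * w i‖ₑ ∂(Measure.pi fun _ : Fin m => P) := by
  set ν := (Measure.pi fun _ : Fin m => P).prod Q
  have hneg : MeasurePreserving (fun p : (Fin m → ℝ) × ℝ => ((fun i => -p.1 i), -p.2)) ν ν :=
    (measurePreserving_pi (fun _ : Fin m => P) (fun _ => P) (fun _ => hP)).prod hQ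
  have hms : MeasurableSet {p : (Fin m → ℝ) × ℝ | 0 < ∑ i, p.1 i * z i + p.2} :=
    measurableSet_lt measurable_const (by fun_prop)
  have hmf : Measurable ({p : (Fin m → ℝ) × ℝ | 0 < ∑ i, p.1 i * z i + p.2}.indicator
      (fun p => ‖∑ i, p.1 i * v i‖ₑ)) := Measurable.indicator (by fun_prop) hms
  have hfst : ∫⁻ w, ‖∑ i, v i * w i‖ₑ ∂(Measure.pi fun _ : Fin m => P) =
      ∫⁻ p, ‖∑ i, p.1 i * v i‖ₑ ∂ν := by
    rw [← (measurePreserving_fst (μ := Measure.pi fun _ : Fin m => P) (ν := Q)).lintegral_comp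
      (f := fun w => ‖∑ i, v i * w i‖ₑ) (by fun_prop)]
    simp only [mul_comm, ν]
  rw [hfst, two_mul]
  -- One of the two copies is evaluated at `-p`; almost surely exactly one of `p`, `-p` is active,
  -- so the two indicators add up to one.
  nth_rewrite 2 [← hneg.lintegral_comp hmf]
  rw [← lintegral_add_left hmf]
  refine lintegral_congr_ae ?_
  filter_upwards [ae_preactivation_ne_zero P hQa z] with p hp
  simp only [indicator_apply, mem_ofPred_eq, neg_mul, Finset.sum_neg_distrib, enorm_neg]
  rcases lt_or_gt_of_ne hp with h | h
  · rw [if_neg (by linarith), if_pos (by linarith), zero_add]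
  · rw [if_pos (by linarith), if_neg (by linarith), add_zero]

lemma enorm_mul_le_lintegral_active (hP : MeasurePreserving (fun s : ℝ => -s) P P)
    (hQ : MeasurePreserving (fun s : ℝ => -s) Q Q) (hQa : NullSingletonClass Q)
    (z v : EuclideanSpace ℝ (Fin m)) :
    ‖v‖ₑ * ∫⁻ s, ‖s‖ₑ ∂P ≤ ENNReal.ofReal (2 * √2) *
      ∫⁻ p, {p : (Fin m → ℝ) × ℝ | 0 < ∑ i, p.1 i * z i + p.2}.indicator
        (fun p => ‖∑ i, p.1 i * v i‖ₑ) p ∂(Measure.pi fun _ : Fin m => P).prod Q := by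
  refine (enorm_mul_lintegral_enorm_le hP v).trans_eq ?_
  rw [← lintegral_active_eq hP hQ hQa z v, ENNReal.ofReal_mul zero_le_two, ← mul_assoc,
    mul_comm (ENNReal.ofReal √2)]
  simp

end Row

/-- Functions of disjoint sets of coordinates are independent under a product measure. -/
lemma DependsOn.indepFun_pi {ι β γ : Type*} [Fintype ι] {X : ι → Type*}
    [∀ i, MeasurableSpace (X i)] [∀ i, Nonempty (X i)] [MeasurableSpace β] [MeasurableSpace γ]
    {ν : ∀ i, Measure (X i)} [∀ i, IsProbabilityMeasure (ν i)] {S T : Set ι} (hST : Disjoint S T)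
    {f : (∀ i, X i) → β} {g : (∀ i, X i) → γ} (hf : Measurable f) (hg : Measurable g)
    (hfS : DependsOn f S) (hgT : DependsOn g T) : IndepFun f g (Measure.pi ν) := by
  classical
  have hindep : iIndepFun (fun i (θ : ∀ i, X i) => θ i) (Measure.pi ν) :=
    iIndepFun_pi (X := fun i x => x) fun i => aemeasurable_id
  have h := hindep.indepFun_finset S.toFinset T.toFinset (by simpa using hST)
    fun i => measurable_pi_apply i
  -- Missing coordinates are filled with arbitrary values; `f` and `g` do not see them.
  have ext_meas : ∀ U : Finset ι, Measurable fun (r : ∀ i : U, X i) (i : ι) =>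
      if hi : i ∈ U then r ⟨i, hi⟩ else Classical.arbitrary (X i) := by
    intro U
    refine measurable_pi_lambda _ fun i => ?_
    by_cases hi : i ∈ U
    · simp only [hi, dif_pos]
      exact measurable_pi_apply _
    · simp only [hi, dif_neg, not_false_iff]
      exact measurable_const
  have key := h.comp (hf.comp (ext_meas _)) (hg.comp (ext_meas _))
  convert key using 1
  · ext θ
    exact hfS fun i hi => by simp [hi]
  · ext θ
    exact hgT fun i hi => by simp [hi]

/-! ### Differentiating through a ReLU layer -/

section Relu

variable {m k : ℕ}

lemma continuous_relu : Continuous (relu : (Fin k → ℝ) → EuclideanSpace ℝ (Fin k)) :=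
  (PiLp.continuous_toLp 2 _).comp (by fun_prop)

/-- Away from the kink, continuity keeps the sign of each pre-activation near `t`, so each
coordinate is locally either zero or the pre-activation itself. -/
lemma hasDerivAt_relu_comp {Z : ℝ → EuclideanSpace ℝ (Fin m)} {v : EuclideanSpace ℝ (Fin m)}
    {t : ℝ} (hZ : HasDerivAt Z v t) (M : Matrix (Fin k) (Fin m) ℝ) (β : Fin k → ℝ)
    (hne : ∀ j, ∑ i, M j i * Z t i + β j ≠ 0) :
    HasDerivAt (fun s => relu (Matrix.mulVec M (Z s).ofLp + β))
      (WithLp.toLp 2 fun j =>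
        if 0 < ∑ i, M j i * Z t i + β j then ∑ i, M j i * v i else 0) t := by
  have hcoord : ∀ i, HasDerivAt (fun s => Z s i) (v i) t := fun i =>
    ((EuclideanSpace.proj (𝕜 := ℝ) i).hasFDerivAt.comp_hasDerivAt t hZ)
  have hlin : ∀ j, HasDerivAt (fun s => ∑ i, M j i * Z s i + β j) (∑ i, M j i * v i) t := fun j =>
    (HasDerivAt.fun_sum fun i _ => (hcoord i).const_mul (M j i)).add_const (β j)
  have hpi : HasDerivAt (fun s (j : Fin k) => max (∑ i, M j i * Z s i + β j) 0)
      (fun j => if 0 < ∑ i, M j i * Z t i + β j then ∑ i, M j i * v i else 0) t := by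
    rw [hasDerivAt_pi]
    intro j
    have hc := (hlin j).continuousAt
    rcases lt_or_gt_of_ne (hne j) with h | h
    · rw [if_neg h.not_gt]
      refine (hasDerivAt_const t (0 : ℝ)).congr_of_eventuallyEq ?_
      filter_upwards [hc.eventually_lt continuousAt_const h] with s hs
      exact max_eq_right hs.le
    · rw [if_pos h]
      refine (hlin j).congr_of_eventuallyEq ?_
      filter_upwards [continuousAt_const.eventually_lt hc h] with s hs
      exact max_eq_left hs.le
  exact (PiLp.continuousLinearEquiv 2 ℝ (fun _ : Fin k => ℝ)).symm.hasFDerivAt.comp_hasDerivAt t hpi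

lemma sum_enorm_le_sqrt_mul_enorm (v : EuclideanSpace ℝ (Fin k)) :
    ∑ j, ‖v j‖ₑ ≤ ENNReal.ofReal √k * ‖v‖ₑ := by
  have h := Real.sum_mul_le_sqrt_mul_sqrt Finset.univ (fun _ : Fin k => (1 : ℝ)) (fun j => ‖v j‖)
  simp only [one_mul, one_pow, Finset.sum_const, Finset.card_univ, Fintype.card_fin, nsmul_eq_mul,
    mul_one, ← EuclideanSpace.norm_eq] at h
  calc ∑ j, ‖v j‖ₑ = ENNReal.ofReal (∑ j, ‖v j‖) := by
        rw [ENNReal.ofReal_sum_of_nonneg fun _ _ => norm_nonneg _]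
        simp only [ofReal_norm]
    _ ≤ ENNReal.ofReal (√k * ‖v‖) := ENNReal.ofReal_le_ofReal h
    _ = _ := by rw [ENNReal.ofReal_mul (Real.sqrt_nonneg _), ofReal_norm]

end Relu

/-! ### The network as a function of its parameter vector -/

/-- The indices of all weights and biases of a network. -/
abbrev ParamIndex (n k D : ℕ) : Type :=
  (Σ l : Fin D, Fin k × Fin (layerWidth n k l)) ⊕ (Fin D × Fin k)

/-- The post-activation vector of a network as a function of the vector of its parameters. -/
noncomputable def paramNet {n k D : ℕ} (θ : ParamIndex n k D → ℝ) (x : EuclideanSpace ℝ (Fin n))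
    (d : ℕ) (hd : d ≤ D) : EuclideanSpace ℝ (Fin (layerWidth n k d)) :=
  postActivation (fun l i j => θ (Sum.inl ⟨l, (i, j)⟩)) (fun l i => θ (Sum.inr (l, i))) x d hd

/-- The indices of the parameters in layers below `d`. -/
def paramsBelow (n k D d : ℕ) : Set (ParamIndex n k D) :=
  {p | Sum.elim (fun q => (q.1 : ℕ)) (fun q => (q.1 : ℕ)) p < d}

section Net

variable {n k D : ℕ}

lemma paramNet_succ (θ : ParamIndex n k D → ℝ) (x : EuclideanSpace ℝ (Fin n)) (d : ℕ)
    (hd : d + 1 ≤ D) :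
    paramNet θ x (d + 1) hd =
      relu (Matrix.mulVec (fun i j => θ (Sum.inl ⟨⟨d, hd⟩, (i, j)⟩))
        (paramNet θ x d (Nat.le_of_succ_le hd)).ofLp + fun i => θ (Sum.inr (⟨d, hd⟩, i))) := rfl

/-- Joint continuity is what makes the time derivative jointly measurable in parameters and time. -/
lemma continuous_paramNet (d : ℕ) (hd : d ≤ D) :
    Continuous fun p : (ParamIndex n k D → ℝ) × EuclideanSpace ℝ (Fin n) =>
      paramNet p.1 p.2 d hd := by
  induction d with
  | zero => exact continuous_snd
  | succ d ih =>
    simp only [paramNet_succ]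
    refine continuous_relu.comp (Continuous.add (Continuous.matrix_mulVec ?_ ?_) ?_)
    · exact continuous_matrix fun i j => by fun_prop
    · exact (PiLp.continuous_ofLp 2 _).comp (ih (Nat.le_of_succ_le hd))
    · fun_prop

lemma dependsOn_paramNet (x : EuclideanSpace ℝ (Fin n)) (d : ℕ) (hd : d ≤ D) :
    DependsOn (fun θ : ParamIndex n k D → ℝ => paramNet θ x d hd) (paramsBelow n k D d) := by
  induction d with
  | zero => exact fun _ _ _ => rfl
  | succ d ih =>
    intro θ θ' h
    have h1 : paramNet θ x d (Nat.le_of_succ_le hd) = paramNet θ' x d (Nat.le_of_succ_le hd) :=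
      ih _ fun i hi => h i (lt_trans hi (Nat.lt_succ_self d))
    have h2 : ∀ i j, θ (Sum.inl ⟨⟨d, hd⟩, (i, j)⟩) = θ' (Sum.inl ⟨⟨d, hd⟩, (i, j)⟩) :=
      fun i j => h _ (Nat.lt_succ_self d)
    have h3 : ∀ i, θ (Sum.inr (⟨d, hd⟩, i)) = θ' (Sum.inr (⟨d, hd⟩, i)) :=
      fun i => h _ (Nat.lt_succ_self d)
    simp only [paramNet_succ, h1, h2, h3]
    rfl

variable {P Q : Measure ℝ}
  {ν : ParamIndex n k D → Measure ℝ} [∀ i, IsProbabilityMeasure (ν i)]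

/-- The parameters of a neuron are independent of everything that happens in lower layers. -/
lemma map_prodMk_neuron {β : Type*} [MeasurableSpace β] (hνP : ∀ q, ν (Sum.inl q) = P)
    (hνQ : ∀ q, ν (Sum.inr q) = Q) {d : ℕ} (hd : d < D) (j : Fin k)
    {A : (ParamIndex n k D → ℝ) → β} (hA : Measurable A)
    (hAd : DependsOn A (paramsBelow n k D d)) :
    (Measure.pi ν).map (fun θ => (A θ, ((fun i : Fin (layerWidth n k d) =>
        θ (Sum.inl ⟨⟨d, hd⟩, (j, i)⟩)), θ (Sum.inr (⟨d, hd⟩, j))))) =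
      ((Measure.pi ν).map A).prod ((Measure.pi fun _ => P).prod Q) := by
  have hw : Measurable fun (θ : ParamIndex n k D → ℝ) (i : Fin (layerWidth n k d)) =>
      θ (Sum.inl ⟨⟨d, hd⟩, (j, i)⟩) := by fun_prop
  have hb : Measurable fun θ : ParamIndex n k D → ℝ => θ (Sum.inr (⟨d, hd⟩, j)) := by fun_prop
  have h1 : IndepFun A (fun θ => ((fun i : Fin (layerWidth n k d) =>
      θ (Sum.inl ⟨⟨d, hd⟩, (j, i)⟩)), θ (Sum.inr (⟨d, hd⟩, j)))) (Measure.pi ν) := by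
    refine DependsOn.indepFun_pi (S := paramsBelow n k D d) (T := (paramsBelow n k D d)ᶜ)
      disjoint_compl_right hA (hw.prodMk hb) hAd ?_
    intro θ θ' h
    refine Prod.ext (funext fun i => h _ ?_) (h _ ?_) <;> exact lt_irrefl d
  have h2 : IndepFun (fun (θ : ParamIndex n k D → ℝ) (i : Fin (layerWidth n k d)) =>
      θ (Sum.inl ⟨⟨d, hd⟩, (j, i)⟩)) (fun θ => θ (Sum.inr (⟨d, hd⟩, j))) (Measure.pi ν) := by
    refine DependsOn.indepFun_pi (S := range Sum.inl) (T := range Sum.inr)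
      isCompl_range_inl_range_inr.disjoint hw hb ?_ ?_
    · exact fun θ θ' h => funext fun i => h _ ⟨_, rfl⟩
    · exact fun θ θ' h => h _ ⟨_, rfl⟩
  have h3 : (Measure.pi ν).map (fun (θ : ParamIndex n k D → ℝ) (i : Fin (layerWidth n k d)) =>
      θ (Sum.inl ⟨⟨d, hd⟩, (j, i)⟩)) = Measure.pi fun _ => P := by
    have hindep : iIndepFun (fun i (θ : ParamIndex n k D → ℝ) => θ i) (Measure.pi ν) :=
      iIndepFun_pi (X := fun i x => x) fun i => aemeasurable_id
    have hinj : Function.Injective fun i : Fin (layerWidth n k d) =>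
        (Sum.inl ⟨⟨d, hd⟩, (j, i)⟩ : ParamIndex n k D) := by
      intro i i' h
      simpa using h
    rw [(hindep.precomp hinj).map_fun_eq_pi_map fun i =>
      (measurable_pi_apply _).aemeasurable]
    congr 1
    ext1 i
    exact (measurePreserving_eval ν _).map_eq.trans (hνP _)
  rw [h1.map_prod_eq_prod_map_map hA.aemeasurable (hw.prodMk hb).aemeasurable,
    h2.map_prod_eq_prod_map_map hw.aemeasurable hb.aemeasurable, h3]
  congr 2
  exact (measurePreserving_eval ν _).map_eq.trans (hνQ _)

variable {y : ℝ → EuclideanSpace ℝ (Fin n)} {t : ℝ}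

lemma continuous_uncurry_paramNet (hy : Continuous y) (d : ℕ) (hd : d ≤ D) :
    Continuous (Function.uncurry fun (θ : ParamIndex n k D → ℝ) (s : ℝ) =>
      paramNet θ (y s) d hd) :=
  (continuous_paramNet d hd).comp (continuous_fst.prodMk (hy.comp continuous_snd))

lemma measurable_value_deriv_paramNet (hy : Continuous y) (t : ℝ) (d : ℕ) (hd : d ≤ D) :
    Measurable fun θ : ParamIndex n k D → ℝ =>
      (paramNet θ (y t) d hd, deriv (fun s => paramNet θ (y s) d hd) t) := by
  have hc := continuous_uncurry_paramNet (n := n) (k := k) (D := D) hy d hd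
  refine Measurable.prodMk ?_ ?_
  · exact (hc.comp (continuous_id.prodMk continuous_const)).measurable
  · exact (measurable_deriv_with_param hc).comp (measurable_id.prodMk measurable_const)

/-- The whole trajectory in layer `d`, hence also its derivative, is determined by the lower
parameters. -/
lemma dependsOn_value_deriv_paramNet (y : ℝ → EuclideanSpace ℝ (Fin n)) (t : ℝ) (d : ℕ)
    (hd : d ≤ D) :
    DependsOn (fun θ : ParamIndex n k D → ℝ =>
      (paramNet θ (y t) d hd, deriv (fun s => paramNet θ (y s) d hd) t))
      (paramsBelow n k D d) := by
  intro θ θ' h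
  have e : ∀ s, paramNet θ (y s) d hd = paramNet θ' (y s) d hd :=
    fun s => dependsOn_paramNet (y s) d hd h
  simp only [e]

variable [IsProbabilityMeasure P] [IsProbabilityMeasure Q]

lemma ae_neuron_ne_zero (hνP : ∀ q, ν (Sum.inl q) = P)
    (hνQ : ∀ q, ν (Sum.inr q) = Q) (hQa : NullSingletonClass Q) {d : ℕ} (hd : d < D)
    {A : (ParamIndex n k D → ℝ) → EuclideanSpace ℝ (Fin (layerWidth n k d))} (hA : Measurable A)
    (hAd : DependsOn A (paramsBelow n k D d)) (j : Fin k) :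
    ∀ᵐ θ ∂(Measure.pi ν),
      ∑ i, θ (Sum.inl ⟨⟨d, hd⟩, (j, i)⟩) * A θ i + θ (Sum.inr (⟨d, hd⟩, j)) ≠ 0 := by
  have hms : MeasurableSet {q : EuclideanSpace ℝ (Fin (layerWidth n k d)) ×
      ((Fin (layerWidth n k d) → ℝ) × ℝ) | ∑ i, q.2.1 i * q.1 i + q.2.2 ≠ 0} :=
    (measurableSet_singleton (0 : ℝ)).compl.preimage (by fun_prop)
  have hae : ∀ᵐ q ∂(((Measure.pi ν).map A).prod
      ((Measure.pi fun _ : Fin (layerWidth n k d) => P).prod Q)),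
      ∑ i, q.2.1 i * q.1 i + q.2.2 ≠ 0 := by
    rw [Measure.ae_prod_iff_ae_ae hms]
    exact .of_forall fun a => ae_preactivation_ne_zero P hQa a.ofLp
  rw [← map_prodMk_neuron hνP hνQ hd j hA hAd] at hae
  have hmeas : Measurable fun θ : ParamIndex n k D → ℝ =>
      ((fun i : Fin (layerWidth n k d) => θ (Sum.inl ⟨⟨d, hd⟩, (j, i)⟩)),
        θ (Sum.inr (⟨d, hd⟩, j))) := by fun_prop
  exact ae_of_ae_map (hA.prodMk hmeas).aemeasurable hae

lemma ae_preactivation_paramNet_ne_zero (hνP : ∀ q, ν (Sum.inl q) = P)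
    (hνQ : ∀ q, ν (Sum.inr q) = Q) (hQa : NullSingletonClass Q) (hy : Continuous y) (t : ℝ) {d : ℕ}
    (hd : d < D) :
    ∀ᵐ θ ∂(Measure.pi ν), ∀ j : Fin k, ∑ i, θ (Sum.inl ⟨⟨d, hd⟩, (j, i)⟩) *
      paramNet θ (y t) d hd.le i + θ (Sum.inr (⟨d, hd⟩, j)) ≠ 0 := by
  rw [ae_all_iff]
  exact ae_neuron_ne_zero hνP hνQ hQa hd (measurable_value_deriv_paramNet hy t d hd.le).fst
    (dependsOn_paramNet (y t) d hd.le)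

lemma ae_differentiableAt_paramNet (hνP : ∀ q, ν (Sum.inl q) = P)
    (hνQ : ∀ q, ν (Sum.inr q) = Q) (hQa : NullSingletonClass Q) (hy : Continuous y)
    (ht : DifferentiableAt ℝ y t) (d : ℕ) (hd : d ≤ D) :
    ∀ᵐ θ ∂(Measure.pi ν), DifferentiableAt ℝ (fun s => paramNet θ (y s) d hd) t := by
  induction d with
  | zero => exact .of_forall fun θ => ht
  | succ d ih =>
    filter_upwards [ih (Nat.le_of_succ_le hd),
      ae_preactivation_paramNet_ne_zero hνP hνQ hQa hy t hd] with θ h1 h2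
    exact (hasDerivAt_relu_comp h1.hasDerivAt _ _ h2).differentiableAt

/-- One layer of a random ReLU network contracts the expected speed of a trajectory at most by a
constant factor. -/
lemma lintegral_enorm_deriv_paramNet_succ (hνP : ∀ q, ν (Sum.inl q) = P)
    (hνQ : ∀ q, ν (Sum.inr q) = Q) (hP : MeasurePreserving (fun s : ℝ => -s) P P)
    (hQ : MeasurePreserving (fun s : ℝ => -s) Q Q) (hQa : NullSingletonClass Q)
    (hy : Continuous y) (ht : DifferentiableAt ℝ y t) (d : ℕ) (hd : d + 1 ≤ D) :
    ENNReal.ofReal √k * (∫⁻ s, ‖s‖ₑ ∂P) *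
        ∫⁻ θ, ‖deriv (fun s => paramNet θ (y s) d (Nat.le_of_succ_le hd)) t‖ₑ ∂(Measure.pi ν) ≤
      ENNReal.ofReal (2 * √2) *
        ∫⁻ θ, ‖deriv (fun s => paramNet θ (y s) (d + 1) hd) t‖ₑ ∂(Measure.pi ν) := by
  -- The case `k = 0` is split off because a factor `√k` is cancelled at the end.
  rcases Nat.eq_zero_or_pos k with rfl | hk
  · simp
  set A : (ParamIndex n k D → ℝ) → _ := fun θ =>
    (paramNet θ (y t) d (Nat.le_of_succ_le hd),
      deriv (fun s => paramNet θ (y s) d (Nat.le_of_succ_le hd)) t) with hAdef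
  have hA : Measurable A := measurable_value_deriv_paramNet hy t d _
  -- Only measurability and the almost sure coordinate formula of the new derivative matter from
  -- here on.
  suffices H : ∀ G : (ParamIndex n k D → ℝ) → EuclideanSpace ℝ (Fin k), Measurable G →
      (∀ᵐ θ ∂(Measure.pi ν), ∀ j, G θ j =
        if 0 < ∑ i, θ (Sum.inl ⟨⟨d, hd⟩, (j, i)⟩) * (A θ).1 i + θ (Sum.inr (⟨d, hd⟩, j))
        then ∑ i, θ (Sum.inl ⟨⟨d, hd⟩, (j, i)⟩) * (A θ).2 i else 0) →
      ENNReal.ofReal √k * (∫⁻ s, ‖s‖ₑ ∂P) * ∫⁻ θ, ‖(A θ).2‖ₑ ∂(Measure.pi ν) ≤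
        ENNReal.ofReal (2 * √2) * ∫⁻ θ, ‖G θ‖ₑ ∂(Measure.pi ν) by
    refine H (fun θ => deriv (fun s => paramNet θ (y s) (d + 1) hd) t)
      (measurable_value_deriv_paramNet hy t (d + 1) hd).snd ?_
    filter_upwards [ae_differentiableAt_paramNet hνP hνQ hQa hy ht d (Nat.le_of_succ_le hd),
      ae_preactivation_paramNet_ne_zero hνP hνQ hQa hy t hd] with θ h1 h2 j
    exact congrArg (fun v : EuclideanSpace ℝ (Fin k) => v j)
      (hasDerivAt_relu_comp h1.hasDerivAt _ _ h2).deriv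
  intro G hG hGval
  have hneuron : ∀ j : Fin k, (∫⁻ s, ‖s‖ₑ ∂P) * ∫⁻ θ, ‖(A θ).2‖ₑ ∂(Measure.pi ν) ≤
      ENNReal.ofReal (2 * √2) *
        ∫⁻ θ, ‖G θ j‖ₑ ∂(Measure.pi ν) := by
    intro j
    have hmap := map_prodMk_neuron hνP hνQ hd j hA (dependsOn_value_deriv_paramNet y t d _)
    set F : (EuclideanSpace ℝ (Fin (layerWidth n k d)) ×
        EuclideanSpace ℝ (Fin (layerWidth n k d))) ×
        ((Fin (layerWidth n k d) → ℝ) × ℝ) → ENNReal := fun q =>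
      {p : (Fin (layerWidth n k d) → ℝ) × ℝ | 0 < ∑ i, p.1 i * q.1.1 i + p.2}.indicator
        (fun p => ‖∑ i, p.1 i * q.1.2 i‖ₑ) q.2 with hF
    have hFm : Measurable F := by
      simp only [hF, indicator_apply, mem_ofPred_eq]
      exact Measurable.ite (measurableSet_lt measurable_const (by fun_prop)) (by fun_prop)
        measurable_const
    have hcoord : ∫⁻ θ, ‖G θ j‖ₑ ∂(Measure.pi ν) =
        ∫⁻ a, ∫⁻ p, F (a, p) ∂((Measure.pi fun _ => P).prod Q) ∂((Measure.pi ν).map A) := by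
      rw [← lintegral_prod _ hFm.aemeasurable, ← hmap,
        lintegral_map hFm (hA.prodMk (by fun_prop))]
      refine lintegral_congr_ae ?_
      filter_upwards [hGval] with θ h
      simp only [h j, hF, indicator_apply, mem_ofPred_eq]
      split_ifs <;> simp
    rw [hcoord, ← lintegral_const_mul _ (hA.snd.enorm), ← lintegral_const_mul _
      hFm.lintegral_prod_right', ← lintegral_map (f := fun a => (∫⁻ s, ‖s‖ₑ ∂P) * ‖a.2‖ₑ)
      (by fun_prop) hA]
    refine lintegral_mono fun a => ?_
    rw [mul_comm]
    exact enorm_mul_le_lintegral_active hP hQ hQa a.1 a.2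
  have hsum := Finset.sum_le_sum fun j (_ : j ∈ Finset.univ) => hneuron j
  rw [Finset.sum_const, Finset.card_univ, Fintype.card_fin, nsmul_eq_mul, ← Finset.mul_sum,
    ← lintegral_finsetSum _ (fun j _ => by fun_prop)] at hsum
  have hle : ∫⁻ θ, ∑ j, ‖G θ j‖ₑ ∂(Measure.pi ν) ≤
      ENNReal.ofReal √k *
        ∫⁻ θ, ‖G θ‖ₑ ∂(Measure.pi ν) := by
    rw [← lintegral_const_mul _ hG.enorm]
    exact lintegral_mono fun θ => sum_enorm_le_sqrt_mul_enorm _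
  have hk0 : ENNReal.ofReal √k ≠ 0 := by simp [hk]
  -- The sum over neurons gains `k` and the passage from `ℓ¹` to `ℓ²` loses `√k`; multiplying by
  -- `√k` avoids a division.
  rw [← ENNReal.mul_le_mul_iff_right hk0 ENNReal.ofReal_ne_top]
  calc ENNReal.ofReal √k * (ENNReal.ofReal √k * (∫⁻ s, ‖s‖ₑ ∂P) * ∫⁻ θ, ‖(A θ).2‖ₑ ∂(Measure.pi ν))
      = (k : ENNReal) * ((∫⁻ s, ‖s‖ₑ ∂P) * ∫⁻ θ, ‖(A θ).2‖ₑ ∂(Measure.pi ν)) := by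
        rw [← mul_assoc, ← mul_assoc, ← ENNReal.ofReal_mul (Real.sqrt_nonneg _),
          Real.mul_self_sqrt (Nat.cast_nonneg _), ENNReal.ofReal_natCast, mul_assoc]
    _ ≤ _ := hsum
    _ ≤ ENNReal.ofReal (2 * √2) * (ENNReal.ofReal √k *
        ∫⁻ θ, ‖G θ‖ₑ ∂(Measure.pi ν)) := by
        gcongr
    _ = _ := by ring

end Net

/-! ### Expected speed and expected length -/

section Length

variable {n k D : ℕ} {P Q : Measure ℝ} [IsProbabilityMeasure P] [IsProbabilityMeasure Q]
  {ν : ParamIndex n k D → Measure ℝ} [∀ i, IsProbabilityMeasure (ν i)]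
  {y : ℝ → EuclideanSpace ℝ (Fin n)} {t : ℝ}

/-- The expected speed of the image of a trajectory in layer `d`. -/
lemma pow_mul_enorm_deriv_le (hνP : ∀ q, ν (Sum.inl q) = P)
    (hνQ : ∀ q, ν (Sum.inr q) = Q) (hP : MeasurePreserving (fun s : ℝ => -s) P P)
    (hQ : MeasurePreserving (fun s : ℝ => -s) Q Q) (hQa : NullSingletonClass Q)
    (hy : Continuous y) (ht : DifferentiableAt ℝ y t) (d : ℕ) (hd : d ≤ D) :
    (ENNReal.ofReal √k * (∫⁻ s, ‖s‖ₑ ∂P)) ^ d * ‖deriv y t‖ₑ ≤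
      ENNReal.ofReal (2 * √2) ^ d *
        ∫⁻ θ, ‖deriv (fun s => paramNet θ (y s) d hd) t‖ₑ ∂(Measure.pi ν) := by
  induction d with
  | zero =>
    have h : ∀ θ : ParamIndex n k D → ℝ, (fun s => paramNet θ (y s) 0 hd) = y := fun θ => rfl
    simp only [h, pow_zero, one_mul, lintegral_const, measure_univ, mul_one]
    exact le_rfl
  | succ d ih =>
    calc (ENNReal.ofReal √k * (∫⁻ s, ‖s‖ₑ ∂P)) ^ (d + 1) * ‖deriv y t‖ₑ
        = ENNReal.ofReal √k * (∫⁻ s, ‖s‖ₑ ∂P) *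
          ((ENNReal.ofReal √k * (∫⁻ s, ‖s‖ₑ ∂P)) ^ d * ‖deriv y t‖ₑ) := by ring
      _ ≤ ENNReal.ofReal √k * (∫⁻ s, ‖s‖ₑ ∂P) * (ENNReal.ofReal (2 * √2) ^ d *
          ∫⁻ θ, ‖deriv (fun s => paramNet θ (y s) d (Nat.le_of_succ_le hd)) t‖ₑ
            ∂(Measure.pi ν)) := by
        exact mul_le_mul_right (ih _) _
      _ = ENNReal.ofReal (2 * √2) ^ d * (ENNReal.ofReal √k * (∫⁻ s, ‖s‖ₑ ∂P) *
          ∫⁻ θ, ‖deriv (fun s => paramNet θ (y s) d (Nat.le_of_succ_le hd)) t‖ₑ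
            ∂(Measure.pi ν)) := by ring
      _ ≤ ENNReal.ofReal (2 * √2) ^ d * (ENNReal.ofReal (2 * √2) *
          ∫⁻ θ, ‖deriv (fun s => paramNet θ (y s) (d + 1) hd) t‖ₑ ∂(Measure.pi ν)) := by
        exact mul_le_mul_right
          (lintegral_enorm_deriv_paramNet_succ hνP hνQ hP hQ hQa hy ht d hd) _
      _ = _ := by ring

lemma measurable_enorm_deriv_paramNet (hy : Continuous y) (d : ℕ) (hd : d ≤ D) :
    Measurable fun p : (ParamIndex n k D → ℝ) × ℝ =>
      ‖deriv (fun s => paramNet p.1 (y s) d hd) p.2‖ₑ :=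
  (measurable_deriv_with_param (continuous_uncurry_paramNet hy d hd)).enorm

lemma measurable_trajectoryLength_paramNet (hy : Continuous y) (d : ℕ) (hd : d ≤ D) :
    Measurable fun θ : ParamIndex n k D → ℝ =>
      trajectoryLength fun s => paramNet θ (y s) d hd :=
  (measurable_enorm_deriv_paramNet hy d hd).lintegral_prod_right'

/-- Fubini exchanges the quantifiers: the exceptional parameter set depends on `t`, but the joint
set of differentiability is measurable. -/
lemma ae_ae_differentiableAt_paramNet (hνP : ∀ q, ν (Sum.inl q) = P)
    (hνQ : ∀ q, ν (Sum.inr q) = Q) (hQa : NullSingletonClass Q) (hy : Continuous y)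
    (hy' : ∀ᵐ t ∂(volume.restrict (Icc (0 : ℝ) 1)), DifferentiableAt ℝ y t)
    (d : ℕ) (hd : d ≤ D) :
    ∀ᵐ θ ∂(Measure.pi ν), ∀ᵐ t ∂(volume.restrict (Icc (0 : ℝ) 1)),
      DifferentiableAt ℝ (fun s => paramNet θ (y s) d hd) t := by
  rw [Measure.ae_ae_comm]
  · filter_upwards [hy'] with t ht
    exact ae_differentiableAt_paramNet hνP hνQ hQa hy ht d hd
  · exact measurableSet_of_differentiableAt_with_param ℝ (continuous_uncurry_paramNet hy d hd)

lemma pow_mul_trajectoryLength_le (hνP : ∀ q, ν (Sum.inl q) = P)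
    (hνQ : ∀ q, ν (Sum.inr q) = Q) (hP : MeasurePreserving (fun s : ℝ => -s) P P)
    (hQ : MeasurePreserving (fun s : ℝ => -s) Q Q) (hQa : NullSingletonClass Q)
    (hy : Continuous y) (hy' : ∀ᵐ t ∂(volume.restrict (Icc (0 : ℝ) 1)), DifferentiableAt ℝ y t)
    (d : ℕ) (hd : d ≤ D) :
    (ENNReal.ofReal √k * (∫⁻ s, ‖s‖ₑ ∂P)) ^ d * trajectoryLength y ≤
      ENNReal.ofReal (2 * √2) ^ d *
        ∫⁻ θ, trajectoryLength (fun s => paramNet θ (y s) d hd) ∂(Measure.pi ν) := by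
  have hm := measurable_enorm_deriv_paramNet (k := k) (D := D) hy d hd
  unfold trajectoryLength
  rw [lintegral_lintegral_swap hm.aemeasurable,
    ← lintegral_const_mul _ (measurable_deriv y).enorm,
    ← lintegral_const_mul _ hm.lintegral_prod_left']
  refine lintegral_mono_ae ?_
  filter_upwards [hy'] with t ht
  exact pow_mul_enorm_deriv_le hνP hνQ hP hQ hQa hy ht d hd

end Length

/-! ### Independence of the values outside the unit interval -/

/-- `deriv` is two-sided, so the endpoints may differ; they form a null set, and in the open
interval the two curves agree locally. -/
lemma trajectoryLength_congr {m : ℕ} {x y : ℝ → EuclideanSpace ℝ (Fin m)}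
    (h : EqOn x y (Icc 0 1)) : trajectoryLength x = trajectoryLength y := by
  unfold trajectoryLength
  rw [← Measure.restrict_congr_set Ioo_ae_eq_Icc]
  refine setLIntegral_congr_fun measurableSet_Ioo fun t ht => ?_
  have he : x =ᶠ[nhds t] y := by
    filter_upwards [Icc_mem_nhds ht.1 ht.2] with s hs using h hs
  simp only [he.deriv_eq]

lemma ae_differentiableAt_congr {m : ℕ} {x y : ℝ → EuclideanSpace ℝ (Fin m)}
    (h : EqOn x y (Icc 0 1))
    (hx : ∀ᵐ t ∂(volume.restrict (Icc (0 : ℝ) 1)), DifferentiableAt ℝ x t) :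
    ∀ᵐ t ∂(volume.restrict (Icc (0 : ℝ) 1)), DifferentiableAt ℝ y t := by
  rw [← Measure.restrict_congr_set Ioo_ae_eq_Icc] at hx ⊢
  filter_upwards [hx, ae_restrict_mem measurableSet_Ioo] with t ht htI
  have he : x =ᶠ[nhds t] y := by
    filter_upwards [Icc_mem_nhds htI.1 htI.2] with s hs using h hs
  exact ht.congr_of_eventuallyEq he.symm

/-! ### Transfer to a random network -/

section RandomNetwork

variable {Ω : Type*} [MeasurableSpace Ω] {μ : Measure Ω} {n k D : ℕ} {α : ℝ} {P Q : Measure ℝ}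
  {W : (l : Fin D) → Ω → Matrix (Fin k) (Fin (layerWidth n k l)) ℝ}
  {b : Fin D → Ω → Fin k → ℝ}

/-- The vector of all parameters of a random network. -/
def networkParams (W : (l : Fin D) → Ω → Matrix (Fin k) (Fin (layerWidth n k l)) ℝ)
    (b : Fin D → Ω → Fin k → ℝ) (ω : Ω) : ParamIndex n k D → ℝ :=
  fun p => Sum.elim
    (fun (p : Σ l : Fin D, Fin k × Fin (layerWidth n k l)) (ω : Ω) => W p.1 ω p.2.1 p.2.2)
    (fun (q : Fin D × Fin k) (ω : Ω) => b q.1 ω q.2) p ω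

lemma IsRandomSparseNetwork.hasLaw_networkParams [IsProbabilityMeasure μ]
    (h : IsRandomSparseNetwork μ α P Q W b) :
    HasLaw (networkParams W b)
      (Measure.pi (Sum.elim (fun _ => sparseMixture α P) (fun _ => Q))) μ := by
  have hlaw : ∀ p : ParamIndex n k D, HasLaw (fun ω => networkParams W b ω p)
      (Sum.elim (fun _ => sparseMixture α P) (fun _ => Q) p) μ := by
    rintro (⟨l, i, j⟩ | ⟨l, i⟩)
    · exact h.weight_law l i j
    · exact h.bias_law l i
  refine ⟨aemeasurable_pi_lambda _ fun p => (hlaw p).aemeasurable, ?_⟩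
  refine (h.indep.map_fun_eq_pi_map fun p => (hlaw p).aemeasurable).trans ?_
  congr 1
  ext1 p
  exact (hlaw p).map_eq

end RandomNetwork

theorem corollary2
    {Ω : Type*} [MeasurableSpace Ω] (μ : Measure Ω) [IsProbabilityMeasure μ]
    {n k D : ℕ} (α C_w C_b : ℝ) (hα : α ∈ Icc (0 : ℝ) 1) (hCw : 0 < C_w) (hCb : 0 < C_b)
    (W : (l : Fin D) → Ω → Matrix (Fin k) (Fin (layerWidth n k l)) ℝ)
    (b : Fin D → Ω → Fin k → ℝ)
    (hnet : IsSparseUniformNetwork μ α C_w C_b W b)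
    (x : ℝ → EuclideanSpace ℝ (Fin n)) (hx : ContinuousOn x (Icc 0 1))
    (hx' : ∀ᵐ t ∂(volume.restrict (Icc (0 : ℝ) 1)), DifferentiableAt ℝ x t)
    (d : ℕ) (hd : d ≤ D) :
    -- the moment bound for the nonzero weights
    (∀ (m : ℕ) (u : EuclideanSpace ℝ (Fin m)),
      C_w / (2 * Real.sqrt 2) * ‖u‖ ≤
        ∫ w : Fin m → ℝ, |∑ i, u i * w i| ∂(Measure.pi fun _ => symmUniform C_w)) ∧
    -- the length of the image in layer `d` is a well-defined random variable
    (∀ᵐ ω ∂μ, ∀ᵐ t ∂(volume.restrict (Icc (0 : ℝ) 1)), DifferentiableAt ℝ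
      (fun s => postActivation (fun l => W l ω) (fun l => b l ω) (x s) d hd) t) ∧
    AEMeasurable (fun ω => trajectoryLength
      (fun t => postActivation (fun l => W l ω) (fun l => b l ω) (x t) d hd)) μ ∧
    -- the lower bound for its expectation
    ENNReal.ofReal ((α * C_w * Real.sqrt k / (4 * Real.sqrt 2)) ^ d) * trajectoryLength x ≤
      ∫⁻ ω, trajectoryLength
        (fun t => postActivation (fun l => W l ω) (fun l => b l ω) (x t) d hd) ∂μ := by
  have := isProbabilityMeasure_symmUniform hCw
  have := isProbabilityMeasure_symmUniform hCb
  have := isProbabilityMeasure_sparseMixture hα (symmUniform C_w)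
  have hlaw := IsRandomSparseNetwork.hasLaw_networkParams hnet
  set ν : ParamIndex n k D → Measure ℝ :=
    Sum.elim (fun _ => sparseMixture α (symmUniform C_w)) (fun _ => symmUniform C_b) with hν
  have hprob : ∀ p, IsProbabilityMeasure (ν p) := by
    rintro (q | q) <;> simp only [hν, Sum.elim_inl, Sum.elim_inr] <;> infer_instance
  -- The measurability results need a curve continuous on the whole line, while `x` is arbitrary
  -- outside `[0, 1]`; `y` extends it by constants.
  set y : ℝ → EuclideanSpace ℝ (Fin n) := IccExtend zero_le_one ((Icc 0 1).domRestrict x)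
  have hy : Continuous y := (continuousOn_iff_continuous_domRestrict.1 hx).Icc_extend'
  have hxy : EqOn x y (Icc 0 1) := fun t ht => (IccExtend_of_mem zero_le_one ((Icc 0 1).domRestrict x) ht).symm
  have hy' := ae_differentiableAt_congr hxy hx'
  have hnetxy : ∀ ω, EqOn
      (fun s => postActivation (fun l => W l ω) (fun l => b l ω) (x s) d hd)
      (fun s => paramNet (networkParams W b ω) (y s) d hd) (Icc 0 1) := by
    intro ω s hs
    simp only [hxy hs]
    rfl
  have hlen : ∀ ω, trajectoryLength
      (fun s => postActivation (fun l => W l ω) (fun l => b l ω) (x s) d hd) =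
      trajectoryLength (fun s => paramNet (networkParams W b ω) (y s) d hd) :=
    fun ω => trajectoryLength_congr (hnetxy ω)
  have hmeas := measurable_trajectoryLength_paramNet (k := k) (D := D) hy d hd
  have hQa := nullSingletonClass_symmUniform C_b
  refine ⟨mul_norm_le_integral_abs_symmUniform hCw, ?_, ?_, ?_⟩
  · have h := ae_ae_differentiableAt_paramNet (P := sparseMixture α (symmUniform C_w))
      (Q := symmUniform C_b) (ν := ν) (fun _ => rfl) (fun _ => rfl)
      hQa hy hy' d hd
    rw [← hlaw.map_eq] at h
    filter_upwards [ae_of_ae_map hlaw.aemeasurable h] with ω hω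
    exact ae_differentiableAt_congr (hnetxy ω).symm hω
  · simp only [hlen]
    exact hmeas.comp_aemeasurable hlaw.aemeasurable
  · simp only [hlen]
    have h := pow_mul_trajectoryLength_le (P := sparseMixture α (symmUniform C_w))
      (Q := symmUniform C_b) (ν := ν) (fun _ => rfl) (fun _ => rfl)
      (measurePreserving_neg_sparseMixture α (measurePreserving_neg_symmUniform C_w))
      (measurePreserving_neg_symmUniform C_b) hQa hy hy' d hd
    rw [lintegral_enorm_sparseMixture hα.1 hCw, ← trajectoryLength_congr hxy, ← hlaw.map_eq,
      lintegral_map' hmeas.aemeasurable hlaw.aemeasurable] at h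
    have h2 : (0 : ℝ) < 2 * √2 := by positivity
    have hc : (0 : ℝ) ≤ α * C_w * √k / (4 * √2) := by
      have := hα.1
      positivity
    -- Per layer, `√k · α C_w / 2 = 2√2 · (α C_w √k / (4√2))`; the factor `2√2` then cancels.
    have hpow : (ENNReal.ofReal √k * ENNReal.ofReal (α * C_w / 2)) ^ d =
        ENNReal.ofReal (2 * √2) ^ d * ENNReal.ofReal ((α * C_w * √k / (4 * √2)) ^ d) := by
      rw [← ENNReal.ofReal_mul (Real.sqrt_nonneg _), ENNReal.ofReal_pow hc, ← mul_pow,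
        ← ENNReal.ofReal_mul h2.le]
      congr 2
      field_simp
      ring
    rw [hpow, mul_assoc] at h
    exact (ENNReal.mul_le_mul_iff_right (pow_ne_zero _ (by simp))
      (ENNReal.pow_ne_top ENNReal.ofReal_ne_top)).1 h
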